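/- For $f:\{0,1\}^n\to\{0,1\}$ let $\eta(f)=\min_{a\in\{0,1\}^n,\,b\in\{0,1\}}2^{-n}\,|\{x: f(x)\neq (a\cdot x)\oplus b\}|$ be its normalised non-linearity, let $\hat f(a)=2^{-n}\sum_x(-1)^{f(x)\oplus a\cdot x}$ be its Walsh coefficients, and let $\hat f_{\max}=\max_a|\hat f(a)|$. A $T$-query quantum algorithm starts in $|0\cdots 0\rangle$ on $n+1+m$ qubits ($m$ arbitrary), applies $T$ calls to the oracle $U_f:|x,b,w\rangle\mapsto|x,b\oplus f(x),w\rangle$ interleaved with arbitrary unitaries that do not depend on $f$, measures in the computational basis, and computes its output from the outcome. **Theorem.** Estimating the non-linearity of a Boolean function with additive accuracy $\lambda$ needs $\Omega(1/\sqrt\lambda)$ quantum queries. Precisely, for every error probability $\delta\in[0,\tfrac12)$ there is a constant $c>0$, depending only on $\delta$, such that the following hold for all $n$ and all $\lambda$ with $2^{-(n+1)}\le\lambda\le\tfrac18$. 1. If a $T$-query algorithm outputs, for every $f:\{0,1\}^n\to\{0,1\}$, with probability at least $1-\delta$ the endpoints of an interval of length at most $\lambda$ containing $\eta(f)$, then $T\ge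 c/\sqrt\lambda$. 2. If $\lambda<\tfrac18$ and a $T$-query algorithm outputs, for every $f:\{0,1\}^n\to\{0,1\}$, with probability at least $1-\delta$ a number $r$ with $|r-\eta(f)|\le\lambda$, then $T\ge c/\sqrt\lambda$. 3. If $2^{n+1}\lambda$ is an integer, every algorithm that decides with error probability at most $\delta$ whether $\hat f_{\max}=1$ or $\hat f_{\max}=1-4\lambda$, given the promise that one of these holds, uses at least $c/\sqrt\lambda$ queries. 4. If $2^{n+1}\lambda$ is an integer and $n$ is even, every algorithm that decides with error probability at most $\delta$ whether $\hat f_{\max}=2^{-n/2}$ (that is, $f$ is bent) or $\hat f_{\max}=2^{-n/2}+4\lambda$, given the promise that one of these holds, uses at least $c/\sqrt\lambda$ queries. -/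

import Mathlib

open scoped Matrix

/-- An `n`-bit Boolean function, bits being elements of `𝔽₂ = ZMod 2`. -/
abbrev BoolFun (n : ℕ) : Type := (Fin n → ZMod 2) → ZMod 2

namespace BoolFun

/-- The affine Boolean function `x ↦ a · x + b` over `𝔽₂`. -/
def affine {n : ℕ} (a : Fin n → ZMod 2) (b : ZMod 2) : BoolFun n :=
  fun x => a ⬝ᵥ x + b

/-- The normalised non-linearity: the minimum, over all affine functions (a finite nonempty
family), of the Hamming distance between truth tables, divided by `2 ^ n`. -/
noncomputable def nonlinearity {n : ℕ} (f : BoolFun n) : ℝ :=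
  ⨅ p : (Fin n → ZMod 2) × ZMod 2, (hammingDist f (affine p.1 p.2) : ℝ) / 2 ^ n

/-- The normalised Walsh coefficient `2⁻ⁿ ∑ₓ (-1) ^ (f x ⊕ x · a)`. -/
noncomputable def walsh {n : ℕ} (f : BoolFun n) (a : Fin n → ZMod 2) : ℝ :=
  (∑ x : Fin n → ZMod 2, (-1 : ℝ) ^ (f x + x ⬝ᵥ a).val) / 2 ^ n

/-- The largest absolute value of a Walsh coefficient. -/
noncomputable def walshMax {n : ℕ} (f : BoolFun n) : ℝ :=
  ⨆ a : Fin n → ZMod 2, |walsh f a|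

end BoolFun

/-- Labels `(x, b, w)` of the computational basis of a register made of `n` query input qubits,
one query output qubit and `m` work qubits. -/
abbrev RegBasis (n m : ℕ) : Type := (Fin n → ZMod 2) × ZMod 2 × (Fin m → ZMod 2)

/-- The oracle `U_f`, acting on amplitude vectors: the linear map with
`|x, b, w⟩ ↦ |x, b ⊕ f x, w⟩` (see `oracle_single`). -/
def oracle {n m : ℕ} (f : BoolFun n) (ψ : RegBasis n m → ℂ) : RegBasis n m → ℂ :=
  fun z => ψ (z.1, z.2.1 - f z.1, z.2.2)

theorem oracle_single {n m : ℕ} (f : BoolFun n) (x : Fin n → ZMod 2) (b : ZMod 2)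
    (w : Fin m → ZMod 2) :
    oracle f (Pi.single (x, b, w) 1) = Pi.single (x, b + f x, w) 1 := by
  funext z
  obtain ⟨x', b', w'⟩ := z
  simp only [oracle, Pi.single_apply, Prod.mk.injEq]
  congr 1
  apply propext
  constructor
  · rintro ⟨rfl, h, rfl⟩
    exact ⟨rfl, by rw [← h]; ring, rfl⟩
  · rintro ⟨rfl, h, rfl⟩
    exact ⟨rfl, by rw [h]; ring, rfl⟩

/-- A quantum query algorithm for `n`-bit Boolean functions with outputs in `α`. It starts in
`|0…0⟩`, applies `gate 0`, then `queries` times the oracle, the `t`-th call being followed by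
`gate t`; finally all qubits are measured in the computational basis and the outcome `z` is
turned into the output `out z`. The gates are arbitrary unitaries that do not depend on the
oracle, and the number of work qubits is arbitrary. -/
structure QueryAlgorithm (n : ℕ) (α : Type) where
  workQubits : ℕ
  queries : ℕ
  gate : ℕ → Matrix.unitaryGroup (RegBasis n workQubits) ℂ
  out : RegBasis n workQubits → α

namespace QueryAlgorithm

/-- The state after `t` oracle calls and the gate that follows them. -/
noncomputable def state {n : ℕ} {α : Type} (A : QueryAlgorithm n α) (f : BoolFun n) :
    ℕ → RegBasis n A.workQubits → ℂ
  | 0 => (A.gate 0).1 *ᵥ Pi.single 0 1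
  | t + 1 => (A.gate (t + 1)).1 *ᵥ oracle f (A.state f t)

open Classical in
/-- The probability (Born rule) that the output of `A` with oracle `f` lies in `S`. -/
noncomputable def prob {n : ℕ} {α : Type} (A : QueryAlgorithm n α) (f : BoolFun n)
    (S : Set α) : ℝ :=
  ∑ z : RegBasis n A.workQubits, if A.out z ∈ S then ‖A.state f A.queries z‖ ^ 2 else 0

/-- On every oracle `f` the algorithm outputs, with probability at least `1 - δ`, the endpoints
of an interval of length at most `lam` that contains the non-linearity of `f`. -/
def EstimatesByInterval {n : ℕ} (A : QueryAlgorithm n (ℝ × ℝ)) (lam δ : ℝ) : Prop :=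
  ∀ f : BoolFun n,
    1 - δ ≤ A.prob f {I | I.2 - I.1 ≤ lam ∧ f.nonlinearity ∈ Set.Icc I.1 I.2}

/-- On every oracle `f` the algorithm outputs, with probability at least `1 - δ`, a number within
`lam` of the non-linearity of `f`. -/
def EstimatesByNumber {n : ℕ} (A : QueryAlgorithm n ℝ) (lam δ : ℝ) : Prop :=
  ∀ f : BoolFun n, 1 - δ ≤ A.prob f {r | |r - f.nonlinearity| ≤ lam}

/-- With error probability at most `δ`, the algorithm decides whether `walshMax f = u` or
`walshMax f = v`, under the promise that one of the two holds. -/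
def DecidesWalshMax {n : ℕ} (A : QueryAlgorithm n Bool) (u v δ : ℝ) : Prop :=
  ∀ f : BoolFun n,
    (f.walshMax = u → 1 - δ ≤ A.prob f {true}) ∧
    (f.walshMax = v → 1 - δ ≤ A.prob f {false})

end QueryAlgorithm

/-! The proof is a hybrid argument. Fix `f` and a set `D` holding at least a quarter of all points.
A `T`-query run on `f` spends total query mass at most `T` on `D`, so by averaging some `k`-element
`S ⊆ D` receives at most `T * k / |D|`. Flipping `f` on `S` moves the final state by at most the sum
of the one-step oracle differences along the run on `f`, which Cauchy–Schwarz bounds by `2 * T * √(k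
/ |D|)`. If every such flip demands an answer incompatible with the one for `f`, the two states must
be at distance at least `(1 - 2 * δ) / 2`. With `k ≤ 4 * lam * 2 ^ n` this gives the bound
(`div_sqrt_le_queries`).

It remains to find rigid instances, where every choice of `S` has the same effect. For the zero
function, flipping `k ≤ 2 ^ n / 4` points always gives non-linearity `k / 2 ^ n`. For a bent
function all Walsh coefficients have equal modulus, so flipping points whose signs oppose the
coefficient at `0` raises that one as much as any coefficient can rise. -/

open Finset in
/-- Among the `k`-element subsets of `D`, some has at most the average weight. -/
theorem exists_subset_card_mul_sum_le {ι : Type*} [DecidableEq ι] (m : ι → ℝ) (k : ℕ)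
    (D : Finset ι) (hk : k ≤ #D) :
    ∃ S ⊆ D, #S = k ∧ #D * ∑ x ∈ S, m x ≤ k * ∑ x ∈ D, m x := by
  induction h : #D - k generalizing D with
  | zero => exact ⟨D, subset_rfl, by omega, by rw [show k = #D by omega]⟩
  | succ j ih =>
    have hD : D.Nonempty := card_pos.mp (by omega)
    -- Discard a heaviest point `a`: adding `∑ x ∈ S, m x ≤ k * m a` to the bound for `D.erase a`
    -- gives the bound for `D`.
    obtain ⟨a, ha, hmax⟩ := exists_max_image D m hD
    have hc := card_erase_of_mem ha
    obtain ⟨S, hS, hSk, hle⟩ := ih (D.erase a) (by omega) (by omega)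
    refine ⟨S, hS.trans (erase_subset _ _), hSk, ?_⟩
    have h1 := add_sum_erase D m ha
    have h2 : ∑ x ∈ D, m x ≤ #D * m a := by
      simpa using sum_le_card_nsmul D m (m a) hmax
    have h3 : ((#(D.erase a) : ℕ) : ℝ) = #D - 1 := by
      rw [hc, Nat.cast_sub (card_pos.mpr hD)]; simp
    have hSa : ∑ x ∈ S, m x ≤ k * m a := by
      simpa [hSk] using sum_le_card_nsmul S m (m a)
        (fun x hx => hmax x (mem_of_mem_erase (hS hx)))
    rw [h3] at hle
    have h4 : ∑ x ∈ D.erase a, m x = ∑ x ∈ D, m x - m a := by linarith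
    rw [h4] at hle
    linarith

/-! ### Amplitude vectors and Born probabilities -/

section L2

variable {ι : Type*} [Fintype ι]

/-- The Euclidean norm of an amplitude vector. -/
noncomputable def ampNorm (ψ : ι → ℂ) : ℝ := ‖WithLp.toLp 2 ψ‖

theorem ampNorm_nonneg (ψ : ι → ℂ) : 0 ≤ ampNorm ψ := norm_nonneg _

theorem ampNorm_sq (ψ : ι → ℂ) : ampNorm ψ ^ 2 = ∑ z, ‖ψ z‖ ^ 2 := by
  simp [ampNorm, EuclideanSpace.norm_sq_eq]

theorem ampNorm_sub_le (ψ φ χ : ι → ℂ) :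
    ampNorm (ψ - χ) ≤ ampNorm (ψ - φ) + ampNorm (φ - χ) := by
  have := norm_sub_le_norm_sub_add_norm_sub
    (WithLp.toLp 2 ψ) (WithLp.toLp 2 φ) (WithLp.toLp 2 χ)
  simpa [ampNorm, ← WithLp.toLp_sub] using this

theorem ampNorm_unitary_mulVec [DecidableEq ι] (U : Matrix.unitaryGroup ι ℂ) (ψ : ι → ℂ) :
    ampNorm (U.1 *ᵥ ψ) = ampNorm ψ := by
  have key : ∀ φ : ι → ℂ, ((∑ z, ‖φ z‖ ^ 2 : ℝ) : ℂ) = star φ ⬝ᵥ φ := by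
    intro φ
    simp only [dotProduct, Complex.ofReal_sum, Pi.star_apply, RCLike.star_def]
    refine Finset.sum_congr rfl fun z _ => ?_
    rw [Complex.conj_mul']; norm_cast
  rw [← sq_eq_sq₀ (ampNorm_nonneg _) (ampNorm_nonneg _), ampNorm_sq, ampNorm_sq]
  apply Complex.ofReal_injective
  rw [key, key, Matrix.star_mulVec, Matrix.dotProduct_mulVec, Matrix.vecMul_vecMul,
    ← Matrix.star_eq_conjTranspose, Matrix.UnitaryGroup.star_mul_self, Matrix.vecMul_one]

/-- Born probabilities of unit vectors differ by at most twice the distance of the vectors. -/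
theorem sum_sq_sub_sum_sq_le (P : ι → Prop) [DecidablePred P] (ψ φ : ι → ℂ)
    (hψ : ampNorm ψ = 1) (hφ : ampNorm φ = 1) :
    (∑ z, if P z then ‖φ z‖ ^ 2 else 0) - (∑ z, if P z then ‖ψ z‖ ^ 2 else 0)
      ≤ 2 * ampNorm (ψ - φ) := by
  have h1 : (∑ z, if P z then ‖φ z‖ ^ 2 else 0) - (∑ z, if P z then ‖ψ z‖ ^ 2 else 0)
      ≤ ∑ z, ‖(ψ - φ) z‖ * (‖ψ z‖ + ‖φ z‖) := by
    rw [← Finset.sum_sub_distrib]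
    refine Finset.sum_le_sum fun z _ => ?_
    have ha := norm_nonneg (ψ z)
    have hb := norm_nonneg (φ z)
    have hc : ‖φ z‖ - ‖ψ z‖ ≤ ‖(ψ - φ) z‖ := by
      rw [Pi.sub_apply, norm_sub_rev]; exact norm_sub_norm_le _ _
    have hd := norm_nonneg ((ψ - φ) z)
    split_ifs
    · nlinarith
    · simpa using mul_nonneg hd (add_nonneg ha hb)
  -- Cauchy–Schwarz; the second factor has squared norm at most 4 for unit vectors.
  refine h1.trans (abs_le_of_sq_le_sq' ?_ (by linarith [ampNorm_nonneg (ψ - φ)])).2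
  have h2 : ∑ z, (‖ψ z‖ + ‖φ z‖) ^ 2 ≤ 4 := by
    calc ∑ z, (‖ψ z‖ + ‖φ z‖) ^ 2 ≤ ∑ z, (2 * ‖ψ z‖ ^ 2 + 2 * ‖φ z‖ ^ 2) :=
          Finset.sum_le_sum fun z _ => by nlinarith [sq_nonneg (‖ψ z‖ - ‖φ z‖)]
      _ = 4 := by
          rw [Finset.sum_add_distrib, ← Finset.mul_sum, ← Finset.mul_sum, ← ampNorm_sq,
            ← ampNorm_sq, hψ, hφ]; norm_num
  calc _ ≤ (∑ z, ‖(ψ - φ) z‖ ^ 2) * ∑ z, (‖ψ z‖ + ‖φ z‖) ^ 2 :=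
        Finset.sum_mul_sq_le_sq_mul_sq _ _ _
    _ ≤ ampNorm (ψ - φ) ^ 2 * 4 := by
        rw [← ampNorm_sq]; exact mul_le_mul_of_nonneg_left h2 (sq_nonneg _)
    _ = _ := by ring

end L2

/-! ### Query mass and the effect of one oracle call -/

/-- The probability that the query register of the state `ψ` holds `x`. -/
noncomputable def queryMass {n m : ℕ} (ψ : RegBasis n m → ℂ) (x : Fin n → ZMod 2) : ℝ :=
  ∑ y : ZMod 2 × (Fin m → ZMod 2), ‖ψ (x, y)‖ ^ 2

theorem sum_queryMass {n m : ℕ} (ψ : RegBasis n m → ℂ) :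
    ∑ x, queryMass ψ x = ampNorm ψ ^ 2 := by
  rw [ampNorm_sq, Fintype.sum_prod_type]; rfl

theorem queryMass_oracle {n m : ℕ} (f : BoolFun n) (ψ : RegBasis n m → ℂ) (x : Fin n → ZMod 2) :
    queryMass (oracle f ψ) x = queryMass ψ x := by
  simp only [queryMass, oracle, Fintype.sum_prod_type]
  exact (Equiv.subRight (f x)).sum_comp fun b => ∑ w, ‖ψ (x, b, w)‖ ^ 2

theorem ampNorm_oracle {n m : ℕ} (f : BoolFun n) (ψ : RegBasis n m → ℂ) :
    ampNorm (oracle f ψ) = ampNorm ψ := by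
  rw [← sq_eq_sq₀ (ampNorm_nonneg _) (ampNorm_nonneg _), ← sum_queryMass, ← sum_queryMass]
  simp only [queryMass_oracle]

theorem oracle_sub {n m : ℕ} (f : BoolFun n) (ψ φ : RegBasis n m → ℂ) :
    oracle f (ψ - φ) = oracle f ψ - oracle f φ := rfl

namespace BoolFun

variable {n : ℕ}

/-- The function obtained from `f` by flipping its values on `S`. -/
def flip (f : BoolFun n) (S : Finset (Fin n → ZMod 2)) : BoolFun n :=
  fun x => f x + if x ∈ S then 1 else 0

/-- The two oracles agree off `S`; over each `x ∈ S` both preserve the mass, and `‖u - v‖² ≤ 2‖u‖² +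
2‖v‖²`. -/
theorem ampNorm_oracle_sub_oracle_flip_sq_le {m : ℕ} (f : BoolFun n)
    (S : Finset (Fin n → ZMod 2)) (ψ : RegBasis n m → ℂ) :
    ampNorm (oracle f ψ - oracle (f.flip S) ψ) ^ 2 ≤ 4 * ∑ x ∈ S, queryMass ψ x := by
  rw [← sum_queryMass, Finset.mul_sum, ← Finset.sum_subset (Finset.subset_univ S)]
  · refine Finset.sum_le_sum fun x _ => ?_
    have h1 := queryMass_oracle f ψ x
    have h2 := queryMass_oracle (f.flip S) ψ x
    have h3 : queryMass (oracle f ψ - oracle (f.flip S) ψ) x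
        ≤ 2 * queryMass (oracle f ψ) x + 2 * queryMass (oracle (f.flip S) ψ) x := by
      simp only [queryMass, Finset.mul_sum, ← Finset.sum_add_distrib]
      refine Finset.sum_le_sum fun y _ => ?_
      have h := norm_sub_le (oracle f ψ (x, y)) (oracle (f.flip S) ψ (x, y))
      have h0 := norm_nonneg (oracle f ψ (x, y) - oracle (f.flip S) ψ (x, y))
      rw [Pi.sub_apply]
      nlinarith [sq_nonneg (‖oracle f ψ (x, y)‖ - ‖oracle (f.flip S) ψ (x, y)‖)]
    linarith
  · intro x _ hx
    refine Finset.sum_eq_zero fun y _ => ?_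
    simp [oracle, flip, hx]

end BoolFun

/-! ### The hybrid argument -/

namespace QueryAlgorithm

variable {n : ℕ} {α : Type}

theorem ampNorm_state (A : QueryAlgorithm n α) (f : BoolFun n) (t : ℕ) :
    ampNorm (A.state f t) = 1 := by
  induction t with
  | zero =>
    rw [state, ampNorm_unitary_mulVec, ← sq_eq_sq₀ (ampNorm_nonneg _) zero_le_one, ampNorm_sq,
      Finset.sum_eq_single 0]
    · simp
    · intro z _ hz; simp [hz]
    · simp
  | succ t ih => rw [state, ampNorm_unitary_mulVec, ampNorm_oracle, ih]

/-- Gates and oracles are isometries, so errors only add up. Both oracles are compared on the states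
of the run on `f`, which lets the flipped set be chosen from that run alone. -/
theorem ampNorm_state_sub_state_le (A : QueryAlgorithm n α) (f g : BoolFun n) (t : ℕ) :
    ampNorm (A.state f t - A.state g t)
      ≤ ∑ i ∈ Finset.range t,
          ampNorm (oracle f (A.state f i) - oracle g (A.state f i)) := by
  induction t with
  | zero => simp [state, ampNorm]
  | succ t ih =>
    rw [Finset.sum_range_succ, state, state, ← Matrix.mulVec_sub, ampNorm_unitary_mulVec, add_comm]
    refine (ampNorm_sub_le _ (oracle g (A.state f t)) _).trans ?_
    rw [← oracle_sub, ampNorm_oracle]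
    linarith

/-- The hybrid argument: some `k`-element subset of `D` can be flipped without moving the final
state far. -/
theorem exists_flip_state_close (A : QueryAlgorithm n α) (f : BoolFun n)
    (D : Finset (Fin n → ZMod 2)) (k : ℕ) (hk : k ≤ D.card) :
    ∃ S ⊆ D, S.card = k ∧
      D.card * ampNorm (A.state f A.queries - A.state (f.flip S) A.queries) ^ 2
        ≤ 4 * A.queries ^ 2 * k := by
  set T := A.queries
  obtain ⟨S, hSD, hSk, hS⟩ := exists_subset_card_mul_sum_le
    (fun x => ∑ i ∈ Finset.range T, queryMass (A.state f i) x) k D hk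
  refine ⟨S, hSD, hSk, ?_⟩
  have hD : ∑ x ∈ D, ∑ i ∈ Finset.range T, queryMass (A.state f i) x ≤ T := by
    calc _ ≤ ∑ x, ∑ i ∈ Finset.range T, queryMass (A.state f i) x :=
          Finset.sum_le_univ_sum_of_nonneg fun x => Finset.sum_nonneg fun i _ =>
            Finset.sum_nonneg fun y _ => sq_nonneg _
      _ = T := by
          rw [Finset.sum_comm]
          simp [sum_queryMass, ampNorm_state]
  have hle : ampNorm (A.state f T - A.state (f.flip S) T) ^ 2
      ≤ T * (4 * ∑ x ∈ S, ∑ i ∈ Finset.range T, queryMass (A.state f i) x) := by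
    calc _ ≤ (∑ i ∈ Finset.range T, ampNorm
            (oracle f (A.state f i) - oracle (f.flip S) (A.state f i))) ^ 2 :=
          pow_le_pow_left₀ (ampNorm_nonneg _) (A.ampNorm_state_sub_state_le f _ T) 2
      _ ≤ T * ∑ i ∈ Finset.range T, ampNorm
            (oracle f (A.state f i) - oracle (f.flip S) (A.state f i)) ^ 2 := by
          simpa using sq_sum_le_card_mul_sum_sq (s := Finset.range T) (f := fun i => ampNorm
            (oracle f (A.state f i) - oracle (f.flip S) (A.state f i)))
      _ ≤ _ := by
          rw [Finset.sum_comm, Finset.mul_sum _ _ (4 : ℝ)]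
          exact mul_le_mul_of_nonneg_left (Finset.sum_le_sum fun i _ =>
            f.ampNorm_oracle_sub_oracle_flip_sq_le S _) (Nat.cast_nonneg _)
  have hT : (0 : ℝ) ≤ T := Nat.cast_nonneg _
  calc _ ≤ (D.card : ℝ) *
        (T * (4 * ∑ x ∈ S, ∑ i ∈ Finset.range T, queryMass (A.state f i) x)) :=
        mul_le_mul_of_nonneg_left hle (Nat.cast_nonneg _)
    _ = 4 * T *
        (D.card * ∑ x ∈ S, ∑ i ∈ Finset.range T, queryMass (A.state f i) x) := by ring
    _ ≤ 4 * T * (k * T) := by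
        refine mul_le_mul_of_nonneg_left (hS.trans ?_) (by positivity)
        exact mul_le_mul_of_nonneg_left hD (Nat.cast_nonneg _)
    _ = _ := by ring

theorem prob_sub_prob_le (A : QueryAlgorithm n α) (f g : BoolFun n) (S : Set α) :
    A.prob g S - A.prob f S ≤ 2 * ampNorm (A.state f A.queries - A.state g A.queries) := by
  classical
  convert sum_sq_sub_sum_sq_le (fun z => A.out z ∈ S) _ _
    (A.ampNorm_state f A.queries) (A.ampNorm_state g A.queries) using 1
  simp only [prob]

theorem prob_add_prob_le_one (A : QueryAlgorithm n α) (f : BoolFun n) {S S' : Set α}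
    (h : Disjoint S S') : A.prob f S + A.prob f S' ≤ 1 := by
  have h1 : ∑ z, ‖A.state f A.queries z‖ ^ 2 = 1 := by
    rw [← ampNorm_sq, ampNorm_state, one_pow]
  rw [prob, prob, ← Finset.sum_add_distrib, ← h1]
  refine Finset.sum_le_sum fun z _ => ?_
  have h2 : ¬ (A.out z ∈ S ∧ A.out z ∈ S') := fun hz => Set.disjoint_left.mp h hz.1 hz.2
  have h3 := sq_nonneg ‖A.state f A.queries z‖
  split_ifs <;> first | (exfalso; tauto) | linarith

/-- Query lower bound for telling `f` from all functions obtained by flipping `k` of its values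
inside a set `D` that holds at least a quarter of all points. -/
theorem div_sqrt_le_queries (A : QueryAlgorithm n α) (f : BoolFun n)
    (D : Finset (Fin n → ZMod 2)) (k : ℕ) (hk : k ≤ D.card) (hD : (2 : ℝ) ^ n ≤ 4 * D.card)
    {lam δ : ℝ} (hlam : 0 < lam) (hkl : (k : ℝ) ≤ 4 * lam * 2 ^ n) {R R' : Set α}
    (hR : Disjoint R R') (hf : 1 - δ ≤ A.prob f R)
    (hg : ∀ S ⊆ D, S.card = k → 1 - δ ≤ A.prob (f.flip S) R') :
    (1 - 2 * δ) / 16 / √lam ≤ A.queries := by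
  obtain ⟨S, hSD, hSk, hS⟩ := A.exists_flip_state_close f D k hk
  have h1 := A.prob_sub_prob_le f (f.flip S) R'
  have h2 := A.prob_add_prob_le_one f hR
  have h3 := hg S hSD hSk
  set a := ampNorm (A.state f A.queries - A.state (f.flip S) A.queries)
  have hT : (0 : ℝ) ≤ A.queries := Nat.cast_nonneg _
  have hDpos : (0 : ℝ) < D.card := by
    have : (0 : ℝ) < 2 ^ n := by positivity
    linarith
  -- The 16 is the 4 of `hkl` times the 4 of `hD`.
  have hkD : (k : ℝ) ≤ D.card * (16 * lam) := by nlinarith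
  have ha : a ≤ A.queries * (8 * √lam) := by
    have h4 : a ^ 2 ≤ (A.queries * (8 * √lam)) ^ 2 := by
      rw [mul_pow, mul_pow, Real.sq_sqrt hlam.le]
      refine le_of_mul_le_mul_left (hS.trans ?_) hDpos
      calc 4 * (A.queries : ℝ) ^ 2 * k ≤ 4 * (A.queries : ℝ) ^ 2 * (D.card * (16 * lam)) :=
            mul_le_mul_of_nonneg_left hkD (by positivity)
        _ = _ := by ring
    exact (abs_le_of_sq_le_sq' h4 (by positivity)).2
  rw [div_le_iff₀ (Real.sqrt_pos.mpr hlam)]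
  linarith

end QueryAlgorithm

/-! ### Signs and character sums -/

section Sign

/-- The sign `(-1) ^ b` of a bit. -/
def bitSign (b : ZMod 2) : ℝ := (-1) ^ b.val

theorem bitSign_zero : bitSign 0 = 1 := by simp [bitSign]

theorem bitSign_one : bitSign 1 = -1 := by simp [bitSign, ZMod.val_one]

theorem forall_zmod_two {p : ZMod 2 → Prop} (h0 : p 0) (h1 : p 1) : ∀ b, p b := by
  intro b
  fin_cases b
  exacts [h0, h1]

theorem bitSign_eq_or (b : ZMod 2) : bitSign b = 1 ∨ bitSign b = -1 :=
  neg_one_pow_eq_or ℝ _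

theorem bitSign_add (a b : ZMod 2) : bitSign (a + b) = bitSign a * bitSign b := by
  revert a b
  refine forall_zmod_two (forall_zmod_two ?_ ?_) (forall_zmod_two ?_ ?_) <;>
    simp [bitSign_zero, bitSign_one, show (1 + 1 : ZMod 2) = 0 from rfl]

theorem bitSign_sum {ι : Type*} (s : Finset ι) (b : ι → ZMod 2) :
    bitSign (∑ i ∈ s, b i) = ∏ i ∈ s, bitSign (b i) := by
  classical
  induction s using Finset.induction_on with
  | empty => simp [bitSign_zero]
  | insert a s ha ih => rw [Finset.sum_insert ha, Finset.prod_insert ha, bitSign_add, ih]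

theorem sum_zmod_two {M : Type*} [AddCommMonoid M] (g : ZMod 2 → M) :
    ∑ b, g b = g 0 + g 1 := Fin.sum_univ_two g

theorem sum_bitSign_dotProduct {n : ℕ} (a : Fin n → ZMod 2) (ha : a ≠ 0) :
    ∑ x : Fin n → ZMod 2, bitSign (x ⬝ᵥ a) = 0 := by
  obtain ⟨i, hi⟩ := Function.ne_iff.mp ha
  have h1 : a i = 1 := by
    revert hi
    generalize a i = b
    revert b
    exact forall_zmod_two (fun h => absurd rfl h) fun _ => rfl
  simp only [dotProduct, bitSign_sum]
  rw [← Fintype.prod_sum (fun i b => bitSign (b * a i))]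
  refine Finset.prod_eq_zero (Finset.mem_univ i) ?_
  rw [sum_zmod_two, h1]
  simp [bitSign_zero, bitSign_one]

end Sign

/-! ### Walsh coefficients, non-linearity and hard instances -/

namespace BoolFun

variable {n : ℕ}

theorem walsh_eq (f : BoolFun n) (a : Fin n → ZMod 2) :
    f.walsh a = (∑ x, bitSign (f x + x ⬝ᵥ a)) / 2 ^ n := rfl

theorem hammingDist_affine_div (f : BoolFun n) (a : Fin n → ZMod 2) (b : ZMod 2) :
    (hammingDist f (affine a b) : ℝ) / 2 ^ n = (1 - bitSign b * f.walsh a) / 2 := by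
  have h : (hammingDist f (affine a b) : ℝ)
      = ∑ x, (1 - bitSign b * bitSign (f x + x ⬝ᵥ a)) / 2 := by
    rw [hammingDist, Finset.card_filter, Nat.cast_sum]
    refine Finset.sum_congr rfl fun x _ => ?_
    rw [affine, dotProduct_comm a x]
    generalize f x = u
    generalize x ⬝ᵥ a = v
    revert u v b
    refine forall_zmod_two (forall_zmod_two (forall_zmod_two ?_ ?_) (forall_zmod_two ?_ ?_))
      (forall_zmod_two (forall_zmod_two ?_ ?_) (forall_zmod_two ?_ ?_)) <;>
    simp [bitSign_zero, bitSign_one, show (1 + 1 : ZMod 2) = 0 from rfl]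
  rw [h, walsh_eq, ← Finset.sum_div, Finset.sum_sub_distrib, ← Finset.mul_sum]
  have h2 : (2 : ℝ) ^ n ≠ 0 := by positivity
  simp
  field_simp

theorem abs_walsh_le_walshMax (f : BoolFun n) (a : Fin n → ZMod 2) :
    |f.walsh a| ≤ f.walshMax :=
  le_ciSup (f := fun a => |f.walsh a|) (Set.finite_range _).bddAbove a

theorem walshMax_eq_of_forall_le (f : BoolFun n) {v : ℝ} (a : Fin n → ZMod 2)
    (ha : |f.walsh a| = v) (h : ∀ b, |f.walsh b| ≤ v) : f.walshMax = v :=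
  le_antisymm (ciSup_le h) (ha ▸ f.abs_walsh_le_walshMax a)

/-- The constant term of the affine function chooses the sign of the Walsh coefficient, so the
minimum sees its absolute value. -/
theorem nonlinearity_eq (f : BoolFun n) : f.nonlinearity = (1 - f.walshMax) / 2 := by
  unfold nonlinearity
  simp only [hammingDist_affine_div]
  apply le_antisymm
  · obtain ⟨a, ha⟩ := exists_eq_ciSup_of_finite (f := fun a => |f.walsh a|)
    have hbdd := (Set.finite_range fun p : (Fin n → ZMod 2) × ZMod 2 =>
      (1 - bitSign p.2 * f.walsh p.1) / 2).bddBelow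
    have hmax : |f.walsh a| = f.walshMax := ha
    rcases abs_choice (f.walsh a) with h | h
    · refine (ciInf_le hbdd (a, 0)).trans_eq ?_
      simp only [bitSign_zero]; rw [← hmax, h, one_mul]
    · refine (ciInf_le hbdd (a, 1)).trans_eq ?_
      simp only [bitSign_one]; rw [← hmax, h, neg_one_mul]
  · refine le_ciInf fun p => ?_
    have h := f.abs_walsh_le_walshMax p.1
    have h2 := abs_le.mp h
    rcases bitSign_eq_or p.2 with hb | hb <;> rw [hb] <;> linarith

theorem walsh_flip (f : BoolFun n) (S : Finset (Fin n → ZMod 2)) (a : Fin n → ZMod 2) :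
    (f.flip S).walsh a = f.walsh a - 2 * (∑ x ∈ S, bitSign (f x + x ⬝ᵥ a)) / 2 ^ n := by
  have h : ∀ x, bitSign (f.flip S x + x ⬝ᵥ a) = bitSign (f x + x ⬝ᵥ a)
      - 2 * if x ∈ S then bitSign (f x + x ⬝ᵥ a) else 0 := by
    intro x
    simp only [flip, bitSign_add]
    split_ifs
    · rw [bitSign_one]; ring
    · rw [bitSign_zero]; ring
  rw [walsh_eq, walsh_eq, Finset.sum_congr rfl fun x _ => h x, Finset.sum_sub_distrib,
    ← Finset.mul_sum, sub_div]
  simp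

theorem abs_walsh_flip_le (f : BoolFun n) (S : Finset (Fin n → ZMod 2)) (a : Fin n → ZMod 2) :
    |(f.flip S).walsh a| ≤ |f.walsh a| + 2 * S.card / 2 ^ n := by
  rw [walsh_flip]
  refine (abs_sub _ _).trans ?_
  gcongr
  rw [abs_div, abs_mul, abs_two, abs_of_pos (by positivity : (0 : ℝ) < 2 ^ n)]
  gcongr
  refine (Finset.abs_sum_le_sum_abs _ _).trans_eq ?_
  rw [Finset.sum_congr rfl (g := fun _ => (1 : ℝ))]
  · simp
  · intro x _
    rcases bitSign_eq_or (f x + x ⬝ᵥ a) with h | h <;> simp [h]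

theorem walsh_zero_zero : (0 : BoolFun n).walsh 0 = 1 := by
  rw [walsh_eq]
  simp [bitSign_zero]

theorem walsh_zero_of_ne {a : Fin n → ZMod 2} (ha : a ≠ 0) : (0 : BoolFun n).walsh a = 0 := by
  rw [walsh_eq]
  simp [sum_bitSign_dotProduct a ha]

theorem walshMax_zero : (0 : BoolFun n).walshMax = 1 := by
  refine walshMax_eq_of_forall_le _ 0 (by rw [walsh_zero_zero, abs_one]) fun b => ?_
  by_cases hb : b = 0
  · rw [hb, walsh_zero_zero, abs_one]
  · simp [walsh_zero_of_ne hb]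

/-- The coefficient at `0` drops to `1 - 2 * S.card / 2 ^ n ≥ 1 / 2`, while the others, initially
zero, reach at most `2 * S.card / 2 ^ n ≤ 1 / 2`. -/
theorem walshMax_flip_zero (S : Finset (Fin n → ZMod 2)) (hS : 4 * (S.card : ℝ) ≤ 2 ^ n) :
    ((0 : BoolFun n).flip S).walshMax = 1 - 2 * S.card / 2 ^ n := by
  have hq : 2 * (S.card : ℝ) / 2 ^ n ≤ 1 / 2 := by
    rw [div_le_div_iff₀ (by positivity) (by norm_num)]; linarith
  have h0 : |((0 : BoolFun n).flip S).walsh 0| = 1 - 2 * S.card / 2 ^ n := by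
    rw [walsh_flip, walsh_zero_zero]
    simp only [Pi.zero_apply, dotProduct_zero, add_zero, bitSign_zero, Finset.sum_const,
      nsmul_eq_mul, mul_one]
    exact abs_of_nonneg (by linarith)
  refine walshMax_eq_of_forall_le _ 0 h0 fun b => ?_
  by_cases hb : b = 0
  · rw [hb, h0]
  · have h := abs_walsh_flip_le 0 S b
    rw [walsh_zero_of_ne hb, abs_zero, zero_add] at h
    linarith

theorem nonlinearity_zero : (0 : BoolFun n).nonlinearity = 0 := by
  rw [nonlinearity_eq, walshMax_zero]; norm_num

theorem nonlinearity_flip_zero (S : Finset (Fin n → ZMod 2)) (hS : 4 * (S.card : ℝ) ≤ 2 ^ n) :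
    ((0 : BoolFun n).flip S).nonlinearity = S.card / 2 ^ n := by
  rw [nonlinearity_eq, walshMax_flip_zero S hS]; ring

/-- In even dimension there is a bent function: the inner product of two halves of the input. -/
theorem exists_bent (r : ℕ) :
    ∃ f : BoolFun (r * 2), ∀ a, |∑ x, bitSign (f x + x ⬝ᵥ a)| = 2 ^ r := by
  let e : Fin r × Fin 2 ≃ Fin (r * 2) := finProdFinEquiv
  let E : (Fin r → Fin 2 → ZMod 2) ≃ (Fin (r * 2) → ZMod 2) :=
    (Equiv.curry (Fin r) (Fin 2) (ZMod 2)).symm.trans (e.arrowCongr (Equiv.refl _))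
  have hE : ∀ y i j, E y (e (i, j)) = y i j := by
    intro y i j
    simp [E]
  refine ⟨fun x => ∑ i, x (e (i, 0)) * x (e (i, 1)), fun a => ?_⟩
  have h : ∀ y : Fin r → Fin 2 → ZMod 2,
      bitSign ((∑ i, E y (e (i, 0)) * E y (e (i, 1))) + E y ⬝ᵥ a)
        = ∏ i, bitSign (y i 0 * y i 1 + (y i 0 * a (e (i, 0)) + y i 1 * a (e (i, 1)))) := by
    intro y
    rw [← bitSign_sum, Finset.sum_add_distrib, dotProduct, ← e.sum_comp, Fintype.sum_prod_type]
    simp only [hE, Fin.sum_univ_two]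
  -- The sum factors over the `r` coordinate pairs; each factor has four signs, three equal and one
  -- opposite, hence modulus 2.
  rw [← E.sum_comp, Finset.sum_congr rfl fun y _ => h y,
    ← Fintype.prod_sum (fun i (u : Fin 2 → ZMod 2) =>
      bitSign (u 0 * u 1 + (u 0 * a (e (i, 0)) + u 1 * a (e (i, 1))))), Finset.abs_prod,
    Finset.prod_eq_pow_card (b := (2 : ℝ))]
  · simp
  · intro i _
    rw [← (finTwoArrowEquiv (ZMod 2)).symm.sum_comp, Fintype.sum_prod_type]
    simp only [sum_zmod_two, finTwoArrowEquiv_symm_apply, Matrix.cons_val_zero,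
      Matrix.cons_val_one]
    generalize a (e (i, 0)) = u
    generalize a (e (i, 1)) = v
    revert u v
    refine forall_zmod_two (forall_zmod_two ?_ ?_) (forall_zmod_two ?_ ?_) <;>
      simp [bitSign_zero, bitSign_one, show (1 + 1 : ZMod 2) = 0 from rfl] <;> norm_num

/-- Flipping any points at which `(-1) ^ f` has the sign opposite to that of its sum raises the
largest Walsh coefficient of a bent function by the maximal amount, and almost half of all points
are of this kind. -/
theorem exists_bent_flip (r : ℕ) (hr : 0 < r) :
    ∃ (f : BoolFun (r * 2)) (D : Finset (Fin (r * 2) → ZMod 2)),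
      (2 : ℝ) ^ (r * 2) ≤ 4 * D.card ∧ f.walshMax = 1 / 2 ^ r ∧
      ∀ S ⊆ D, (f.flip S).walshMax = 1 / 2 ^ r + 2 * S.card / 2 ^ (r * 2) := by
  obtain ⟨f, hf⟩ := exists_bent r
  have hpow : (2 : ℝ) ^ (r * 2) = 2 ^ r * 2 ^ r := by rw [mul_two, pow_add]
  have hpos : (0 : ℝ) < 2 ^ r := by positivity
  have hw : ∀ a, |f.walsh a| = 1 / 2 ^ r := by
    intro a
    rw [walsh_eq, abs_div, hf, hpow, abs_of_pos (by positivity)]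
    field_simp
  obtain ⟨s, hs, hs'⟩ : ∃ s : ℝ, (s = 1 ∨ s = -1) ∧ ∑ x, bitSign (f x) = s * 2 ^ r := by
    have h0 := hf 0
    simp only [dotProduct_zero, add_zero] at h0
    rcases abs_eq hpos.le |>.mp h0 with h | h
    · exact ⟨1, Or.inl rfl, by rw [h, one_mul]⟩
    · exact ⟨-1, Or.inr rfl, by rw [h, neg_one_mul]⟩
  have hss : s * s = 1 := by rcases hs with h | h <;> rw [h] <;> norm_num
  refine ⟨f, Finset.univ.filter fun x => bitSign (f x) = -s, ?_,
    f.walshMax_eq_of_forall_le 0 (hw 0) fun b => (hw b).le, fun S hS => ?_⟩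
  · have hcard : ((Finset.univ.filter fun x => bitSign (f x) = -s).card : ℝ)
        = ∑ x, (1 - s * bitSign (f x)) / 2 := by
      rw [Finset.card_filter, Nat.cast_sum]
      refine Finset.sum_congr rfl fun x _ => ?_
      rcases hs with h | h <;> rcases bitSign_eq_or (f x) with h' | h' <;> rw [h, h'] <;> norm_num
    rw [hcard, ← Finset.sum_div, Finset.sum_sub_distrib, ← Finset.mul_sum, hs', ← mul_assoc, hss]
    -- The set has `(2 ^ (r * 2) - 2 ^ r) / 2` points, which is a quarter of all points or more once
    -- `2 ^ r ≥ 2`.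
    have h2 : (2 : ℝ) ≤ 2 ^ r := le_self_pow₀ one_le_two hr.ne'
    simp only [Finset.sum_const, Finset.card_univ, Fintype.card_fun, ZMod.card, Fintype.card_fin,
      nsmul_eq_mul, mul_one, Nat.cast_pow, Nat.cast_ofNat, one_mul, hpow]
    nlinarith
  · refine walshMax_eq_of_forall_le _ 0 ?_ fun b => ?_
    · have hsum : ∑ x ∈ S, bitSign (f x) = S.card * -s := by
        rw [Finset.sum_congr rfl fun x hx => (Finset.mem_filter.mp (hS hx)).2]
        simp
      have hval : (f.flip S).walsh 0 = s * (1 / 2 ^ r + 2 * S.card / 2 ^ (r * 2)) := by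
        rw [walsh_flip, walsh_eq]
        simp only [dotProduct_zero, add_zero, hsum, hs', hpow]
        field_simp
        ring
      have habs : |s| = 1 := by rcases hs with h | h <;> simp [h]
      rw [hval, abs_mul, habs, one_mul, abs_of_nonneg (by positivity)]
    · exact (abs_walsh_flip_le f S b).trans_eq (by rw [hw])

end BoolFun

/-! ### Choice of parameters and the four bounds -/

/-- The specialisation of `QueryAlgorithm.div_sqrt_le_queries` to the zero function. -/
theorem QueryAlgorithm.div_sqrt_le_queries_zero {n : ℕ} {α : Type} (A : QueryAlgorithm n α) (k : ℕ)
    (hk : 4 * (k : ℝ) ≤ 2 ^ n) {lam δ : ℝ} (hlam : 0 < lam) (hkl : (k : ℝ) ≤ 4 * lam * 2 ^ n)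
    {R R' : Set α} (hR : Disjoint R R') (hf : 1 - δ ≤ A.prob 0 R)
    (hg : ∀ S : Finset (Fin n → ZMod 2), S.card = k →
      1 - δ ≤ A.prob ((0 : BoolFun n).flip S) R') :
    (1 - 2 * δ) / 16 / √lam ≤ A.queries := by
  have hc : (((Finset.univ : Finset (Fin n → ZMod 2)).card : ℕ) : ℝ) = 2 ^ n := by simp
  have hp : (0 : ℝ) < 2 ^ n := by positivity
  refine A.div_sqrt_le_queries 0 Finset.univ k ?_ ?_ hlam hkl hR hf fun S _ => hg S
  · rw [← Nat.cast_le (α := ℝ), hc]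
    linarith [(Nat.cast_nonneg k : (0 : ℝ) ≤ k)]
  · rw [hc]; linarith

/-- For `n ≥ 2` the number `2 ^ n / 4` is an integer, so `j` strictly below it leaves room for `j +
1`. -/
theorem four_mul_add_one_le_two_pow {n j : ℕ} (hn : 2 ≤ n) (h : (j : ℝ) < 2 ^ n / 4) :
    4 * ((j + 1 : ℕ) : ℝ) ≤ 2 ^ n := by
  obtain ⟨l, rfl⟩ := Nat.exists_eq_add_of_le hn
  have h4 : (2 : ℝ) ^ (2 + l) = 4 * 2 ^ l := by rw [pow_add]; norm_num
  rw [h4] at h ⊢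
  have h1 : (j : ℝ) < ((2 ^ l : ℕ) : ℝ) := by push_cast; linarith
  have h2 : ((j + 1 : ℕ) : ℝ) ≤ ((2 ^ l : ℕ) : ℝ) := Nat.cast_le.mpr (Nat.cast_lt.mp h1)
  push_cast at h2 ⊢
  linarith

theorem two_le_of_one_div_two_pow_le {n : ℕ} {lam : ℝ} (h : 1 / 2 ^ (n + 1) ≤ lam)
    (h8 : lam ≤ 1 / 8) : 2 ≤ n := by
  by_contra! hn
  have h1 : (2 : ℝ) ^ (n + 1) ≤ 2 ^ 2 := pow_le_pow_right₀ one_le_two (by omega)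
  have h2 : (1 : ℝ) / 2 ^ 2 ≤ 1 / 2 ^ (n + 1) := one_div_le_one_div_of_le (by positivity) h1
  linarith

theorem theorem6p5 (δ : ℝ) (hδ₀ : 0 ≤ δ) (hδ : δ < 1 / 2) :
    ∃ c : ℝ, 0 < c ∧
      (∀ (n : ℕ) (lam : ℝ), 1 / 2 ^ (n + 1) ≤ lam → lam ≤ 1 / 8 →
        ∀ A : QueryAlgorithm n (ℝ × ℝ), A.EstimatesByInterval lam δ →
          c / √lam ≤ A.queries) ∧
      (∀ (n : ℕ) (lam : ℝ), 1 / 2 ^ (n + 1) ≤ lam → lam < 1 / 8 →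
        ∀ A : QueryAlgorithm n ℝ, A.EstimatesByNumber lam δ →
          c / √lam ≤ A.queries) ∧
      (∀ (n k : ℕ) (lam : ℝ), 1 ≤ k → lam = k / 2 ^ (n + 1) → lam ≤ 1 / 8 →
        ∀ A : QueryAlgorithm n Bool, A.DecidesWalshMax 1 (1 - 4 * lam) δ →
          c / √lam ≤ A.queries) ∧
      (∀ (n k : ℕ) (lam : ℝ), Even n → 1 ≤ k → lam = k / 2 ^ (n + 1) → lam ≤ 1 / 8 →
        ∀ A : QueryAlgorithm n Bool,
          A.DecidesWalshMax (1 / √(2 ^ n)) (1 / √(2 ^ n) + 4 * lam) δ →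
          c / √lam ≤ A.queries) := by
  have hpow : ∀ n : ℕ, (2 : ℝ) ^ (n + 1) = 2 * 2 ^ n := fun n => pow_succ' 2 n
  have hpos : ∀ n : ℕ, (0 : ℝ) < 2 ^ n := fun n => by positivity
  refine ⟨(1 - 2 * δ) / 16, by linarith, ?_, ?_, ?_, ?_⟩
  · intro n lam h1 h8 A hA
    have hn := two_le_of_one_div_two_pow_le h1 h8
    have hlam : 0 < lam := lt_of_lt_of_le (by positivity) h1
    have hp := hpos n
    have h1' : 1 ≤ lam * (2 * 2 ^ n) := by
      rwa [div_le_iff₀ (by positivity), hpow] at h1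
    -- `j + 1` is the least integer above `2 ^ n * lam`: no interval of length `lam` contains both
    -- `0` and `(j + 1) / 2 ^ n`. The lower bound on `lam` absorbs the `+ 1`.
    set j := ⌊2 ^ n * lam⌋₊
    have hj : (j : ℝ) ≤ 2 ^ n * lam := Nat.floor_le (by positivity)
    have hj' : 2 ^ n * lam < ((j + 1 : ℕ) : ℝ) := by
      push_cast; exact Nat.lt_floor_add_one _
    have hk := four_mul_add_one_le_two_pow (j := j) hn (by nlinarith)
    refine A.div_sqrt_le_queries_zero (j + 1) hk hlam (by push_cast; nlinarith) ?_ (hA 0)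
      (R' := {I | I.2 - I.1 ≤ lam ∧ ((j + 1 : ℕ) : ℝ) / 2 ^ n ∈ Set.Icc I.1 I.2}) ?_
    · rw [Set.disjoint_left]
      rintro I ⟨hI, hI1, -⟩ ⟨-, -, hI2⟩
      rw [BoolFun.nonlinearity_zero] at hI1
      have : lam < ((j + 1 : ℕ) : ℝ) / 2 ^ n := by rw [lt_div_iff₀ hp]; linarith
      linarith
    · intro S hS
      have h := hA (BoolFun.flip 0 S)
      rwa [BoolFun.nonlinearity_flip_zero S (by rw [hS]; exact hk), hS] at h
  · intro n lam h1 h8 A hA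
    have hn := two_le_of_one_div_two_pow_le h1 h8.le
    have hlam : 0 < lam := lt_of_lt_of_le (by positivity) h1
    have hp := hpos n
    have h1' : 1 ≤ lam * (2 * 2 ^ n) := by
      rwa [div_le_iff₀ (by positivity), hpow] at h1
    -- Two `lam`-balls are disjoint when their centres are more than `2 * lam` apart. Here `j < 2 ^
    -- n / 4` uses the strict `lam < 1 / 8`.
    set j := ⌊2 ^ n * (2 * lam)⌋₊
    have hj : (j : ℝ) ≤ 2 ^ n * (2 * lam) := Nat.floor_le (by positivity)
    have hj' : 2 ^ n * (2 * lam) < ((j + 1 : ℕ) : ℝ) := by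
      push_cast; exact Nat.lt_floor_add_one _
    have hk := four_mul_add_one_le_two_pow (j := j) hn (by nlinarith)
    refine A.div_sqrt_le_queries_zero (j + 1) hk hlam (by push_cast; nlinarith) ?_ (hA 0)
      (R' := {r | |r - ((j + 1 : ℕ) : ℝ) / 2 ^ n| ≤ lam}) ?_
    · rw [Set.disjoint_left]
      intro r hr hr'
      rw [Set.mem_ofPred_eq, BoolFun.nonlinearity_zero] at hr
      rw [Set.mem_ofPred_eq] at hr'
      have : 2 * lam < ((j + 1 : ℕ) : ℝ) / 2 ^ n := by rw [lt_div_iff₀ hp]; linarith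
      linarith [(abs_le.mp hr).2, (abs_le.mp hr').1]
    · intro S hS
      have h := hA (BoolFun.flip 0 S)
      rwa [BoolFun.nonlinearity_flip_zero S (by rw [hS]; exact hk), hS] at h
  · intro n k lam hk1 hlk h8 A hA
    have hp := hpos n
    have hk0 : (0 : ℝ) < k := by exact_mod_cast hk1
    have hlam : 0 < lam := by rw [hlk]; positivity
    have hlk' : (k : ℝ) = lam * (2 * 2 ^ n) := by
      rw [hlk, hpow]; field_simp
    have hk : 4 * (k : ℝ) ≤ 2 ^ n := by rw [hlk']; nlinarith
    refine A.div_sqrt_le_queries_zero k hk hlam (by nlinarith) (R := {true}) (R' := {false})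
      (by simp) ((hA 0).1 BoolFun.walshMax_zero) fun S hS => (hA _).2 ?_
    rw [BoolFun.walshMax_flip_zero S (by rw [hS]; exact hk), hS, hlk']
    field_simp
    ring
  · intro n k lam hn hk1 hlk h8 A hA
    obtain ⟨r, rfl⟩ : ∃ r, n = r * 2 := by
      obtain ⟨r, hr⟩ := hn
      exact ⟨r, by omega⟩
    have hp := hpos (r * 2)
    have hk0 : (1 : ℝ) ≤ k := by exact_mod_cast hk1
    have hlam : 0 < lam := by rw [hlk]; positivity
    have hlk' : (k : ℝ) = lam * (2 * 2 ^ (r * 2)) := by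
      rw [hlk, hpow]; field_simp
    -- For `r = 0` one would have `k = 2 * lam ≤ 1 / 4`.
    have hr : 0 < r := by
      rcases Nat.eq_zero_or_pos r with rfl | h
      · norm_num at hlk'; linarith
      · exact h
    have hsqrt : √((2 : ℝ) ^ (r * 2)) = 2 ^ r := by
      rw [pow_mul, Real.sqrt_sq (by positivity)]
    rw [hsqrt] at hA
    obtain ⟨f, D, hD, hf, hfS⟩ := BoolFun.exists_bent_flip r hr
    refine A.div_sqrt_le_queries f D k ?_ hD hlam (by nlinarith) (R := {true}) (R' := {false})
      (by simp) ((hA f).1 hf) fun S hS hSk => (hA _).2 ?_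
    · rw [← Nat.cast_le (α := ℝ)]
      nlinarith
    · rw [hfS S hS, hSk, hlk']
      field_simp
      ring
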